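/- Let $k\ge 3$, let $n_1\ge n_2\ge\dots\ge n_k>1$ be integers, and put $N=n_1+\dots+n_k$. Let $G=K_{n_1,\dots,n_k}$ be the (unweighted) complete multipartite graph with parts $X_1,\dots,X_k$, $|X_i|=n_i$: two vertices are adjacent if and only if they lie in different parts. For a spanning tree $T$ of $G$ and an edge $e$ of $T$, the congestion of $e$ is the number of edges of $G$ that join the two connected components of $T-e$; the $L^1$-congestion $\mathcal C_1(G,T)$ is the $\ell^1$-norm of the vector of the congestions of all edges $e$ of $T$, and $\mathcal C_1(G)$ is the minimum of $\mathcal C_1(G,T)$ over all spanning trees $T$ of $G$. Choose points $x\in X_k$ and $y\in X_1$, and let $T_S(k,1)$ be the spanning tree of $G$ in which $x$ is joined to every vertex outside $X_k$ and $y$ is joined to every vertex of $X_k$. Then, for every choice of $x$ and $y$, the minimum is attained at $T_S(k,1)$, and $$\mathcal C_1(G)=\mathcal C_1(G,T_S(k,1))=2\sum_{i=1}^{k-2}\sum_{j=i+1}^{k-1}n_in_j+3(n_k-1)(N-n_k-1)+N-1 .$$ -/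

import Mathlib

/-- `T` is a spanning tree of `G`: a subgraph on the same vertex set which is a tree. -/
def IsSpanningTree {V : Type*} (G T : SimpleGraph V) : Prop :=
  T ≤ G ∧ T.IsTree

/-- The congestion of an edge `e` of a spanning tree `T` of the unweighted graph `G`: the number of
edges of `G` that join the two connected components of `T` with `e` removed. -/
noncomputable def edgeCongestion {V : Type*} (G T : SimpleGraph V) (e : Sym2 V) : ℕ :=
  {f ∈ G.edgeSet | ∃ a ∈ f, ∃ b ∈ f, ¬ (T.deleteEdges {e}).Reachable a b}.ncard

/-- The `L^p`-congestion of a spanning tree `T` of `G`: the `ℓ^p` norm of the vector of the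
congestions of the edges of `T`. -/
noncomputable def lpCongestion {V : Type*} [Finite V] (p : ENNReal) (G T : SimpleGraph V) : ℝ :=
  letI : Fintype T.edgeSet := Fintype.ofFinite T.edgeSet
  ‖(WithLp.toLp p (fun e : T.edgeSet => (edgeCongestion G T (e : Sym2 V) : ℝ)) :
    PiLp p (fun _ : T.edgeSet => ℝ))‖

/-- The set of the `L^p`-congestions of all spanning trees of `G`. Its minimum is the spanning tree
`L^p`-congestion of `G`. -/
def spanningTreeCongestions {V : Type*} [Finite V] (p : ENNReal) (G : SimpleGraph V) : Set ℝ :=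
  {c | ∃ T : SimpleGraph V, IsSpanningTree G T ∧ c = lpCongestion p G T}

/-- The complete multipartite graph with parts of sizes `n 0, …, n (k - 1)`; the `i`-th part
consists of the vertices `⟨i, a⟩` with `a : Fin (n i)`. -/
abbrev completeMultipartite {k : ℕ} (n : Fin k → ℕ) : SimpleGraph (Σ i : Fin k, Fin (n i)) :=
  SimpleGraph.completeMultipartiteGraph (fun i => Fin (n i))

/-- The tree `T_S(i, j)` built on the point `x` of the `i`-th part and the point `y` of the `j`-th
part, `i ≠ j`: `x` is joined to every vertex outside the `i`-th part, and `y` is joined to every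
vertex of the `i`-th part. Its only nonterminal edge is the one joining `x` and `y`. -/
def treeS {k : ℕ} (n : Fin k → ℕ) (i j : Fin k) (x : Fin (n i)) (y : Fin (n j)) :
    SimpleGraph (Σ l : Fin k, Fin (n l)) :=
  SimpleGraph.fromRel fun u v => (u = ⟨i, x⟩ ∧ v.1 ≠ i) ∨ (u = ⟨j, y⟩ ∧ v.1 = i)

/-! An edge of `G` is counted in the congestion of exactly the edges of its tree path, so the
`L¹`-congestion is the sum of `T.dist u v` over the edges `uv` of `G`. Tree edges contribute 1 and
all others at least 2; with the excess defined as the sum of `dist - 2`, truncated at 0, over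
ordered pairs from different parts, the congestion is `2|E(G)| - (N - 1) + excess / 2`. It remains
to minimise the excess.

The core is `IsTree.le_excess`: if every colour occurs at least `a` times, the excess is at least
`2(a - 1)(|S| - a - 1)`. The proof removes deepest leaves: such a leaf reaches everything except its
siblings and parent through its grandparent, hence is far from most points. Either one leaf of an
abundant colour is removed, or a whole family of siblings, and then `a` drops by the largest
multiplicity of a colour in the family. In `treeS` only pairs at distance 3 have excess, and they
attain the bound with `a = n last`. -/

namespace SimpleGraph

/-! ### Geodesics in rooted trees -/

variable {V : Type*} {G T : SimpleGraph V}

/-- In a tree, every path is a geodesic. -/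
lemma IsTree.length_eq_dist (hT : T.IsTree) {u v : V} (p : T.Walk u v) (hp : p.IsPath) :
    p.length = T.dist u v := by
  obtain ⟨q, hq, hl⟩ := hT.connected.exists_path_of_dist u v
  rw [(hT.existsUnique_path u v).unique hp hq, hl]

/-- In a tree, a vertex has at most one neighbour closer to the root. -/
lemma IsTree.eq_of_adj_of_dist_add_one (hT : T.IsTree) {r v u u' : V} (h : T.Adj v u)
    (h' : T.Adj v u') (hu : T.dist r u + 1 = T.dist r v) (hu' : T.dist r u' + 1 = T.dist r v) :
    u = u' := by
  obtain ⟨p, hp⟩ := hT.connected.exists_walk_length_eq_dist r u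
  obtain ⟨q, hq⟩ := hT.connected.exists_walk_length_eq_dist r u'
  have hP := (p.concat h.symm).isPath_of_length_eq_dist (by simp [hp, hu])
  have hQ := (q.concat h'.symm).isPath_of_length_eq_dist (by simp [hq, hu'])
  have := congrArg Walk.penultimate ((hT.existsUnique_path r v).unique hP hQ)
  simpa using this

/-- Every vertex other than the root has a neighbour closer to the root. -/
lemma Connected.exists_adj_dist_add_one (hT : T.Connected) {r v : V} (h : v ≠ r) :
    ∃ u, T.Adj v u ∧ T.dist r u + 1 = T.dist r v := by
  obtain ⟨p, hp⟩ := hT.exists_walk_length_eq_dist v r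
  cases p with
  | nil => exact absurd rfl h
  | @cons _ u _ hadj q =>
    refine ⟨u, hadj, ?_⟩
    have h1 := dist_le q
    have h2 := hT.dist_triangle (u := v) (v := u) (w := r)
    rw [dist_eq_one_iff_adj.2 hadj] at h2
    rw [dist_comm (u := r), dist_comm (u := r) (v := v)]
    simp only [Walk.length_cons] at hp
    omega

/-- A path in a tree which starts by moving away from the root keeps moving away from it. -/
lemma IsTree.dist_eq_of_isPath_cons (hT : T.IsTree) (r : V) {v z : V} (q : T.Walk v z) :
    ∀ {u : V} (h : T.Adj u v), (Walk.cons h q).IsPath → T.dist r v = T.dist r u + 1 →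
      T.dist r z = T.dist r u + q.length + 1 := by
  induction q with
  | nil => intro u h _ hd; simpa using hd
  | @cons v v' z h' q ih =>
    intro u h hp hd
    have hp' := hp.of_cons
    rcases hT.dist_eq_dist_add_one_of_adj r h' with h1 | h1
    -- A step back towards the root would return to `u`, which the path has already visited.
    · have hu : v' = u := hT.eq_of_adj_of_dist_add_one h' h.symm h1.symm hd.symm
      subst hu
      simp at hp
    · rw [ih h' hp' h1, hd, Walk.length_cons]
      ring

/-- A geodesic of a rooted tree moves away from the root throughout, or it starts by moving towards
the root. -/
lemma IsTree.dist_eq_or_exists_adj (hT : T.IsTree) (r : V) {u z : V} (h : u ≠ z) :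
    T.dist r z = T.dist r u + T.dist u z ∨
      ∃ v, T.Adj u v ∧ T.dist r v + 1 = T.dist r u ∧ T.dist u z = T.dist v z + 1 := by
  obtain ⟨p, hp, hl⟩ := hT.connected.exists_path_of_dist u z
  cases p with
  | nil => exact absurd rfl h
  | @cons _ v _ hadj q =>
    rw [Walk.length_cons] at hl
    rcases hT.dist_eq_dist_add_one_of_adj r hadj with h1 | h1
    · exact .inr ⟨v, hadj, h1.symm, by rw [← hl, hT.length_eq_dist q hp.of_cons]⟩
    · left
      rw [hT.dist_eq_of_isPath_cons r q hadj hp h1, ← hl]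
      ring

/-! ### Congestion as a sum of tree distances -/

open scoped Classical in
/-- The number of edges of a tree which separate two vertices is the distance of the vertices. -/
lemma IsTree.card_separating_edges [Fintype T.edgeSet] (hT : T.IsTree) (u v : V) :
    (Finset.univ.filter fun e : T.edgeSet =>
      ¬ (T.deleteEdges {(e : Sym2 V)}).Reachable u v).card = T.dist u v := by
  obtain ⟨p, hp, hl⟩ := hT.connected.exists_path_of_dist u v
  rw [← hl, ← p.length_edges, ← List.toFinset_card_of_nodup hp.isTrail.edges_nodup,
    ← Finset.card_map (Function.Embedding.subtype _)]
  congr 1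
  ext e
  simp only [Finset.mem_map, Finset.mem_filter, Finset.mem_univ, true_and,
    Function.Embedding.subtype_apply, Subtype.exists, List.mem_toFinset]
  constructor
  · rintro ⟨e', he', h, rfl⟩
    exact p.mem_edges_of_not_reachable_deleteEdges h
  · intro he
    refine ⟨e, p.edges_subset_edgeSet he, ?_, rfl⟩
    rintro ⟨q⟩
    have hq := q.bypass_isPath.mapLe (T.deleteEdges_le {e})
    rw [(hT.existsUnique_path u v).unique hp hq, Walk.edges_mapLe_eq_edges] at he
    have := q.bypass.edges_subset_edgeSet he
    simp at this

-- Ordered pairs of vertices allow the sums over tree edges and over edges of `G` to be exchanged;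
-- each edge is then counted twice.
open scoped Classical in
lemma two_mul_edgeCongestion [Fintype V] (e : Sym2 V) :
    2 * edgeCongestion G T e =
      ∑ u, ∑ v, if G.Adj u v ∧ ¬ (T.deleteEdges {e}).Reachable u v then 1 else 0 := by
  let H : SimpleGraph V :=
    { Adj := fun u v => G.Adj u v ∧ ¬ (T.deleteEdges {e}).Reachable u v
      symm := ⟨fun u v h => ⟨h.1.symm, fun h' => h.2 h'.symm⟩⟩
      loopless := ⟨fun u h => h.1.ne rfl⟩ }
  have hH : {f ∈ G.edgeSet | ∃ a ∈ f, ∃ b ∈ f, ¬ (T.deleteEdges {e}).Reachable a b} =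
      H.edgeSet := by
    ext f
    induction f with
    | _ u v =>
      simp only [Set.mem_ofPred_eq, mem_edgeSet, Sym2.mem_iff, exists_eq_or_imp,
        exists_eq_left, Reachable.refl, not_true_eq_false, false_or, or_false, H]
      rw [(T.deleteEdges {e}).reachable_comm (u := v) (v := u), or_self]
  rw [edgeCongestion, hH, ← coe_edgeFinset, Set.ncard_coe_finset, two_mul_card_edgeFinset,
    Finset.card_filter, ← Finset.univ_product_univ, Finset.sum_product]

open scoped Classical in
/-- The `L¹`-congestion of a spanning tree is the sum of the tree distances of the endpoints of the
edges of the graph. -/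
lemma two_mul_lpCongestion_one [Fintype V] (hT : T.IsTree) :
    2 * lpCongestion 1 G T = ((∑ u, ∑ v, if G.Adj u v then T.dist u v else 0 : ℕ) : ℝ) := by
  let : Fintype T.edgeSet := Fintype.ofFinite T.edgeSet
  have h : lpCongestion 1 G T = ((∑ e : T.edgeSet, edgeCongestion G T e : ℕ) : ℝ) := by
    rw [lpCongestion, PiLp.norm_eq_of_L1]
    simp
  rw [h]
  norm_cast
  rw [Finset.mul_sum]
  simp_rw [two_mul_edgeCongestion]
  rw [Finset.sum_comm]
  refine Finset.sum_congr rfl fun u _ => ?_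
  rw [Finset.sum_comm]
  refine Finset.sum_congr rfl fun v _ => ?_
  split_ifs with huv
  · rw [← hT.card_separating_edges u v, Finset.card_filter]
    simp only [huv, true_and]
    congr!
  · simp [huv]

end SimpleGraph

/-! ### Lower bound for the excess -/

namespace SimpleGraph

/-- From a vertex `w`, the vertices which are not deeper than `w`, apart from the parent of `w` and
its other children, are reached through the grandparent of `w`. -/
lemma IsTree.dist_eq_grandparent {V : Type*} {T : SimpleGraph V} (hT : T.IsTree) {r w p g z : V} (hwp : T.Adj w p)
    (hp : T.dist r p + 1 = T.dist r w) (hpg : T.Adj p g) (hg : T.dist r g + 1 = T.dist r p)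
    (hz : T.dist r z ≤ T.dist r w) (hzw : z ≠ w) (hzp : z ≠ p)
    (hzc : ¬ (T.Adj z p ∧ T.dist r p + 1 = T.dist r z)) : T.dist w z = T.dist g z + 2 := by
  have h1 := hT.connected.pos_dist_of_ne hzw.symm
  have h2 := hT.connected.pos_dist_of_ne hzp.symm
  rcases hT.dist_eq_or_exists_adj r hzw.symm with h | ⟨v, hv, hd, h⟩
  · omega
  obtain rfl := hT.eq_of_adj_of_dist_add_one hv hwp hd hp
  rcases hT.dist_eq_or_exists_adj r hzp.symm with h' | ⟨v', hv', hd', h'⟩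
  · have h3 : T.dist v z = 1 := by omega
    exact absurd ⟨(dist_eq_one_iff_adj.1 h3).symm, by omega⟩ hzc
  · obtain rfl := hT.eq_of_adj_of_dist_add_one hv' hpg hd' hg
    omega

section Excess

variable {V κ : Type*} [DecidableEq V] [DecidableEq κ] {T : SimpleGraph V} {c : V → κ}

/-- The sum over `v ∈ B` of a colour different from that of `u` of the amount by which the distance
of `u` and `v` exceeds `2`. -/
noncomputable def excessFrom (T : SimpleGraph V) (c : V → κ) (B : Finset V) (u : V) : ℕ :=
  ∑ v ∈ B, if c u ≠ c v then T.dist u v - 2 else 0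

/-- The sum over the ordered pairs of differently coloured points of `S` of the amount by which
their distance exceeds `2`. -/
noncomputable def excess (T : SimpleGraph V) (c : V → κ) (S : Finset V) : ℕ :=
  ∑ u ∈ S, excessFrom T c S u

/-- Pairs between `W` and `S \ W` occur in both orders, hence the factor 2; pairs inside `W` are
discarded. -/
lemma excess_sdiff_add_le {S W : Finset V} (hW : W ⊆ S) :
    excess T c (S \ W) + 2 * ∑ w ∈ W, excessFrom T c (S \ W) w ≤ excess T c S := by
  have h (u : V) : excessFrom T c S u = excessFrom T c (S \ W) u + excessFrom T c W u :=
    (Finset.sum_sdiff hW).symm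
  have h' : ∑ u ∈ S \ W, excessFrom T c W u = ∑ w ∈ W, excessFrom T c (S \ W) w := by
    simp only [excessFrom]
    rw [Finset.sum_comm]
    refine Finset.sum_congr rfl fun u _ => Finset.sum_congr rfl fun v _ => ?_
    simp only [dist_comm (u := v), ne_comm (a := c v)]
  rw [excess, excess, ← Finset.sum_sdiff hW]
  simp only [h, Finset.sum_add_distrib, h']
  omega

/-- Points of `A` count at least once, those of `B` at least twice. -/
lemma card_add_card_le_excessFrom {w : V} {S A B : Finset V} (hA : A ⊆ S) (hBA : B ⊆ A)
    (hcA : ∀ z ∈ A, c w ≠ c z) (hdA : ∀ z ∈ A, 3 ≤ T.dist w z) (hdB : ∀ z ∈ B, 4 ≤ T.dist w z) :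
    A.card + B.card ≤ excessFrom T c S w := by
  rw [excessFrom, ← Finset.sum_sdiff hA, ← Finset.sum_sdiff hBA]
  have h1 : (A \ B).card ≤ ∑ v ∈ A \ B, if c w ≠ c v then T.dist w v - 2 else 0 := by
    rw [Finset.card_eq_sum_ones]
    refine Finset.sum_le_sum fun v hv => ?_
    have hv := (Finset.mem_sdiff.1 hv).1
    have := hdA v hv
    rw [if_pos (hcA v hv)]
    omega
  have h2 : 2 * B.card ≤ ∑ v ∈ B, if c w ≠ c v then T.dist w v - 2 else 0 := by
    rw [mul_comm, ← smul_eq_mul, ← Finset.sum_const]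
    refine Finset.sum_le_sum fun v hv => ?_
    have := hdB v hv
    rw [if_pos (hcA v (hBA hv))]
    omega
  have h3 := Finset.card_sdiff_add_card_eq_card hBA
  omega

lemma card_filter_sdiff_add {S W : Finset V} (hW : W ⊆ S) (i : κ) :
    ((S \ W).filter (c · = i)).card + (W.filter (c · = i)).card =
      (S.filter (c · = i)).card := by
  simp only [Finset.card_filter]
  exact Finset.sum_sdiff hW

/-- Lower bound for the excess of a part, closed under taking parents, of a rooted tree which is
properly coloured with at least `a` points of every colour. -/
theorem IsTree.le_excess (hT : T.IsTree) (hc : ∀ u v, T.Adj u v → c u ≠ c v) (r : V) (N : ℕ) :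
    ∀ (S : Finset V) (a : ℕ), S.card = N → 1 ≤ a →
      (∀ v ∈ S, ∀ u, T.Adj v u → T.dist r u + 1 = T.dist r v → u ∈ S) →
      (∀ i, a ≤ (S.filter (c · = i)).card) →
      2 * ((a : ℤ) - 1) * (S.card - a - 1) ≤ excess T c S := by
  classical
  induction N using Nat.strong_induction_on with
  | _ N ih =>
  intro S a hN ha1 hS ha
  rcases ha1.eq_or_lt with rfl | ha2
  · simp
  obtain ⟨w₀, hw₀, hmax⟩ : ∃ w ∈ S, ∀ z ∈ S, T.dist r z ≤ T.dist r w := by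
    refine Finset.exists_max_image S (T.dist r) ?_
    have := (ha (c r)).trans (Finset.card_filter_le _ _)
    exact Finset.card_pos.1 (by omega)
  -- At depth at most 1 no point of `S` other than `r` could have the colour of `r`, but `a ≥ 2`.
  have hD : 2 ≤ T.dist r w₀ := by
    by_contra! hD
    have hr : S.filter (c · = c r) ⊆ {r} := by
      intro z hz
      obtain ⟨hz, hzc⟩ := Finset.mem_filter.1 hz
      rw [Finset.mem_singleton]
      by_contra hzr
      have h1 := hT.connected.pos_dist_of_ne (Ne.symm hzr)
      have h2 := hmax z hz
      exact hc r z (dist_eq_one_iff_adj.1 (by omega)) hzc.symm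
    have := (ha (c r)).trans (Finset.card_le_card hr)
    simp at this
    omega
  obtain ⟨p, hw₀p, hp⟩ := hT.connected.exists_adj_dist_add_one (r := r) (v := w₀) (by
    rintro rfl; simp at hD)
  obtain ⟨g, hpg, hg⟩ := hT.connected.exists_adj_dist_add_one (r := r) (v := p) (by
    rintro rfl; simp at hp; omega)
  have hpS : p ∈ S := hS w₀ hw₀ p hw₀p hp
  have hgS : g ∈ S := hS p hpS g hpg hg
  -- The siblings of `w₀` in `S`, itself included: all have maximal depth, so removing any of them
  -- keeps `S` closed under parents.
  set W := S.filter fun z => T.Adj z p ∧ T.dist r p + 1 = T.dist r z with hWdef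
  have hWS : W ⊆ S := Finset.filter_subset _ _
  have hw₀W : w₀ ∈ W := by simp [hWdef, hw₀, hw₀p, hp]
  have hWmem (w : V) (hw : w ∈ W) : w ∈ S ∧ T.Adj w p ∧ T.dist r p + 1 = T.dist r w := by
    simpa [hWdef] using hw
  have hpW : p ∉ W := fun h => (hWmem p h).2.1.ne rfl
  have hgW : g ∉ W := fun h => by have := (hWmem g h).2.2; omega
  have hdist (w : V) (hw : w ∈ W) (z : V) (hz : z ∈ S \ W) (hzp : z ≠ p) :
      T.dist w z = T.dist g z + 2 := by
    obtain ⟨hwS, hwp, hwd⟩ := hWmem w hw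
    obtain ⟨hzS, hzW⟩ := Finset.mem_sdiff.1 hz
    refine hT.dist_eq_grandparent hwp hwd hpg hg ?_ (fun h => hzW (h ▸ hw)) hzp ?_
    · have := hmax z hzS; omega
    · intro h; exact hzW (by simp [hWdef, hzS, h.1, h.2])
  have hclosed (U : Finset V) (hU : U ⊆ W) :
      ∀ v ∈ S \ U, ∀ u, T.Adj v u → T.dist r u + 1 = T.dist r v → u ∈ S \ U := by
    intro v hv u hvu hd
    have hvS := (Finset.mem_sdiff.1 hv).1
    refine Finset.mem_sdiff.2 ⟨hS v hvS u hvu hd, fun hu => ?_⟩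
    have h1 := (hWmem u (hU hu)).2.2
    have h2 := hmax v hvS
    omega
  -- The points of the colour of `p`, other than `p`, are neither in `W` nor equal to `g`, so their
  -- distance from `w` is at least 3.
  have hother (w : V) (hw : w ∈ W) : a - 1 ≤ excessFrom T c (S \ W) w := by
    have hcw := hc w p (hWmem w hw).2.1
    have hsub : (S.filter (c · = c p)).erase p ⊆ S \ W := by
      intro z hz
      simp only [Finset.mem_erase, Finset.mem_filter] at hz
      exact Finset.mem_sdiff.2 ⟨hz.2.1, fun h => hc z p (hWmem z h).2.1 hz.2.2⟩
    have := card_add_card_le_excessFrom (T := T) (c := c) (w := w) (B := ∅) hsub (by simp)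
      (fun z hz => by
        simp only [Finset.mem_erase, Finset.mem_filter] at hz
        rw [hz.2.2]; exact hcw)
      (fun z hz => by
        have hz' := hsub hz
        simp only [Finset.mem_erase, Finset.mem_filter] at hz
        rw [hdist w hw z hz' hz.1]
        have := hT.connected.pos_dist_of_ne (u := g) (v := z) (by
          rintro rfl; exact hc p g hpg hz.2.2.symm)
        omega) (by simp)
    rw [Finset.card_erase_of_mem (by simp [hpS])] at this
    have := ha (c p)
    simp at *
    omega
  -- Removing one point with `a` unchanged lowers the bound by `2(a - 1)`, which `hother` supplies.
  by_cases hex : ∃ w ∈ W, a < (S.filter (c · = c w)).card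
  · obtain ⟨w, hw, hwa⟩ := hex
    have hwS := hWS hw
    have hsub : ({w} : Finset V) ⊆ W := by simpa using hw
    have h1 := excess_sdiff_add_le (T := T) (c := c) (hsub.trans hWS)
    have hcard := Finset.card_sdiff_add_card_eq_card (hsub.trans hWS)
    rw [Finset.card_singleton] at hcard
    have h2 := ih _ (by omega) (S \ {w}) a rfl ha1 (hclosed _ hsub) (fun i => by
      have h3 := card_filter_sdiff_add (c := c) (hsub.trans hWS) i
      have h4 := ha i
      rw [Finset.filter_singleton] at h3
      split_ifs at h3 with h5
      · subst h5
        simp at h3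
        omega
      · simp at h3
        omega)
    have h3 : excessFrom T c (S \ W) w ≤ excessFrom T c (S \ {w}) w :=
      Finset.sum_le_sum_of_subset (Finset.sdiff_subset_sdiff le_rfl hsub)
    have h4 := hother w hw
    rw [Finset.sum_singleton] at h1
    zify [(by omega : 1 ≤ a)] at *
    rw [← hcard]
    nlinarith
  push Not at hex
  have hclass (w : V) (hw : w ∈ W) : (S.filter (c · = c w)).card = a :=
    (hex w hw).antisymm (ha _)
  have hcardW := Finset.card_sdiff_add_card_eq_card hWS
  have hle (i : κ) : (W.filter (c · = i)).card ≤ (S.filter (c · = i)).card :=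
    Finset.card_le_card (Finset.filter_subset_filter _ hWS)
  -- A most frequent colour in `W`; the colour of `g` is preferred.
  obtain ⟨w, hw, hwmax, hwg⟩ : ∃ w ∈ W,
      (∀ w' ∈ W, (W.filter (c · = c w')).card ≤ (W.filter (c · = c w)).card) ∧
      (c g ≠ c w → (W.filter (c · = c g)).card < (W.filter (c · = c w)).card) := by
    obtain ⟨w, hw, hwmax⟩ := Finset.exists_max_image W
      (fun w => (W.filter (c · = c w)).card) ⟨w₀, hw₀W⟩
    by_cases h : (W.filter (c · = c g)).card < (W.filter (c · = c w)).card
    · exact ⟨w, hw, hwmax, fun _ => h⟩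
    · have hpos : 0 < (W.filter (c · = c w)).card :=
        Finset.card_pos.2 ⟨w, by simp [hw]⟩
      obtain ⟨w', hw'⟩ := Finset.card_pos.1 (hpos.trans_le (not_lt.1 h))
      obtain ⟨hw', hc'⟩ := Finset.mem_filter.1 hw'
      refine ⟨w', hw', fun w'' hw'' => ?_, fun h' => absurd hc'.symm h'⟩
      rw [hc']
      exact (hwmax w'' hw'').trans (not_lt.1 h)
  set t := (W.filter (c · = c w)).card with ht
  have htpos : 0 < t := Finset.card_pos.2 ⟨w, by simp [hw]⟩
  have hta : t ≤ a := (hle _).trans (hclass w hw).le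
  have hts : t ≤ W.card := Finset.card_filter_le _ _
  have hsum (L : ℤ) (hL : ∀ w' ∈ W, c w' = c w → L ≤ excessFrom T c (S \ W) w') :
      t * L + (W.card - t) * (a - 1) ≤ ((∑ w' ∈ W, excessFrom T c (S \ W) w' : ℕ) : ℤ) := by
    have hcard := Finset.card_filter_add_card_filter_not (s := W) (fun w' => c w' = c w)
    have h1 : (t : ℤ) * L ≤ ∑ w' ∈ W with c w' = c w, (excessFrom T c (S \ W) w' : ℤ) := by
      rw [ht, ← nsmul_eq_mul]
      refine Finset.card_nsmul_le_sum _ _ _ fun w' hw' => ?_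
      exact hL w' (Finset.mem_filter.1 hw').1 (Finset.mem_filter.1 hw').2
    have h2 : ((W.card : ℤ) - t) * (a - 1) ≤
        ∑ w' ∈ W with ¬ c w' = c w, (excessFrom T c (S \ W) w' : ℤ) := by
      rw [← hcard, ← ht]
      push_cast
      rw [add_sub_cancel_left, ← nsmul_eq_mul]
      refine Finset.card_nsmul_le_sum _ _ _ fun w' hw' => ?_
      have := hother w' (Finset.mem_filter.1 hw').1
      omega
    rw [Nat.cast_sum, ← Finset.sum_filter_add_sum_filter_not W (fun w' => c w' = c w)]
    exact add_le_add h1 h2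
  have hpR : p ∈ S \ W := Finset.mem_sdiff.2 ⟨hpS, hpW⟩
  have hgR : g ∈ S \ W := Finset.mem_sdiff.2 ⟨hgS, hgW⟩
  have hclassR := card_filter_sdiff_add (c := c) hWS (c w)
  rw [hclass w hw, ← ht] at hclassR
  have hclassg := card_filter_sdiff_add (c := c) hWS (c g)
  have hgpos : 0 < ((S \ W).filter (c · = c g)).card := Finset.card_pos.2 ⟨g, by simp [hgR]⟩
  have hag := ha (c g)
  have hsplit := Finset.card_filter_add_card_filter_not (s := S \ W) (fun z => c z = c w)
  have hpw : c p ≠ c w := (hc w p (hWmem w hw).2.1).symm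
  have hfar (w' : V) (hw' : w' ∈ W) (z : V) (hz : z ∈ S \ W) (hzp : z ≠ p) (hzg : z ≠ g) :
      3 ≤ T.dist w' z := by
    have := hT.connected.pos_dist_of_ne hzg.symm
    rw [hdist w' hw' z hz hzp]
    omega
  have hsame (hgw : c g = c w) (w' : V) (hw' : w' ∈ W) (hcw : c w' = c w) :
      (S \ W).card + t ≤ excessFrom T c (S \ W) w' + a + 1 := by
    have := card_add_card_le_excessFrom (T := T) (c := c) (w := w') (B := ∅)
      (A := ((S \ W).filter fun z => ¬ c z = c w).erase p)
      ((Finset.erase_subset _ _).trans (Finset.filter_subset _ _)) (by simp)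
      (fun z hz => by
        simp only [Finset.mem_erase, Finset.mem_filter] at hz
        rw [hcw]; exact Ne.symm hz.2.2)
      (fun z hz => by
        simp only [Finset.mem_erase, Finset.mem_filter] at hz
        exact hfar w' hw' z hz.2.1 hz.1 (by rintro rfl; exact hz.2.2 hgw)) (by simp)
    rw [Finset.card_erase_of_mem (Finset.mem_filter.2 ⟨hpR, hpw⟩), Finset.card_empty] at this
    omega
  -- Now `g`, at distance 2, is lost from the count, but the other points of its colour are not
  -- adjacent to it, hence at distance at least 4 from `w'`, and count twice.
  have hdiff (hgw : c g ≠ c w) (w' : V) (hw' : w' ∈ W) (hcw : c w' = c w) :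
      (S \ W).card + t + ((S \ W).filter (c · = c g)).card ≤
        excessFrom T c (S \ W) w' + a + 3 := by
    have hgp := hc p g hpg
    have := card_add_card_le_excessFrom (T := T) (c := c) (w := w')
      (B := ((S \ W).filter fun z => c z = c g).erase g)
      (A := (((S \ W).filter fun z => ¬ c z = c w).erase p).erase g)
      ((Finset.erase_subset _ _).trans <|
        (Finset.erase_subset _ _).trans (Finset.filter_subset _ _))
      (fun z hz => by
        simp only [Finset.mem_erase, Finset.mem_filter] at hz ⊢
        refine ⟨hz.1, ?_, hz.2.1, ?_⟩
        · rintro rfl; exact hgp hz.2.2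
        · rw [hz.2.2]; exact hgw)
      (fun z hz => by
        simp only [Finset.mem_erase, Finset.mem_filter] at hz
        rw [hcw]; exact Ne.symm hz.2.2.2)
      (fun z hz => by
        simp only [Finset.mem_erase, Finset.mem_filter] at hz
        exact hfar w' hw' z hz.2.2.1 hz.2.1 hz.1)
      (fun z hz => by
        simp only [Finset.mem_erase, Finset.mem_filter] at hz
        rw [hdist w' hw' z hz.2.1 (by rintro rfl; exact hgp hz.2.2)]
        have := hT.connected.one_lt_dist_of_ne_of_not_adj hz.1.symm
          (fun h => hc g z h hz.2.2.symm)
        omega)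
    rw [Finset.card_erase_of_mem (s := (S \ W).filter (c · = c g)) (by simp [hgR]),
      Finset.card_erase_of_mem (Finset.mem_erase.2
        ⟨fun h => hgp (congrArg c h).symm, Finset.mem_filter.2 ⟨hgR, hgw⟩⟩),
      Finset.card_erase_of_mem (Finset.mem_filter.2 ⟨hpR, hpw⟩)] at this
    omega
  have hex_le := excess_sdiff_add_le (T := T) (c := c) hWS
  rcases hta.lt_or_eq with hta | hta
  · have hrec := ih _ (by omega) (S \ W) (a - t) rfl (by omega) (hclosed W subset_rfl)
      (fun i => by
        have h1 := card_filter_sdiff_add (c := c) hWS i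
        rcases (W.filter (c · = i)).eq_empty_or_nonempty with h2 | ⟨w', hw'⟩
        · rw [h2, Finset.card_empty] at h1
          have := ha i
          omega
        · obtain ⟨hwW, rfl⟩ := Finset.mem_filter.1 hw'
          have h2 := hwmax w' hwW
          have h3 := ha (c w')
          omega)
    have h1 := hsum ((S \ W).card + t - a - 1) (fun w' hw' hcw => by
      by_cases hgw : c g = c w
      · have := hsame hgw w' hw' hcw
        omega
      -- The strict inequality `hwg` leaves at least two points of the colour of `g` in `S \ W`,
      -- which compensates for losing `g`.
      · have := hdiff hgw w' hw' hcw
        have := hwg hgw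
        omega)
    rw [← hcardW]
    zify [hta.le] at hrec hex_le ⊢
    rw [← hcardW] at *
    push_cast at *
    linarith
  -- The colour of `w` is used up, so induction is unavailable and the excess inside `S \ W` is
  -- bounded by 0. The remaining estimate exceeds the bound by `2(|S \ W| - a - 1)`.
  · have hcard : a + 1 ≤ (S \ W).card := by
      have hsub : insert g (S.filter (c · = c p)) ⊆ S \ W := by
        refine Finset.insert_subset hgR fun z hz => ?_
        obtain ⟨hz, hzp⟩ := Finset.mem_filter.1 hz
        exact Finset.mem_sdiff.2 ⟨hz, fun h => hc z p (hWmem z h).2.1 hzp⟩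
      have h1 := Finset.card_le_card hsub
      rw [Finset.card_insert_of_notMem (by simpa [hgS] using (hc p g hpg).symm)] at h1
      have := ha (c p)
      omega
    have h1 := hsum ((S \ W).card - 2) (fun w' hw' hcw => by
      by_cases hgw : c g = c w
      · have := hsame hgw w' hw' hcw
        omega
      · have := hdiff hgw w' hw' hcw
        omega)
    rw [← hcardW]
    zify at hex_le hcard ⊢
    rw [hta] at h1
    have h2 : (0 : ℤ) ≤ excess T c (S \ W) := by positivity
    push_cast at *
    linarith

end Excess

end SimpleGraph

/-! ### Congestion in terms of the excess -/

namespace SimpleGraph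

open scoped Classical in
/-- In a complete multipartite graph, the `L¹`-congestion of a spanning tree is determined by the
excess of the tree. -/
lemma two_mul_lpCongestion_one_add {V κ : Type*} [Fintype V] [DecidableEq κ] {G T : SimpleGraph V}
    {c : V → κ} (hG : ∀ u v, G.Adj u v ↔ c u ≠ c v) (hTG : T ≤ G) (hT : T.IsTree) :
    2 * lpCongestion 1 G T + 2 * (Fintype.card V - 1) =
      2 * ((∑ u, ∑ v, if c u ≠ c v then 1 else 0 : ℕ) : ℝ) + excess T c Finset.univ := by
  have hedges : ∑ u, ∑ v, (if T.Adj u v then 1 else 0) = 2 * (T.edgeFinset.card) := by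
    rw [two_mul_card_edgeFinset, Finset.card_filter, ← Finset.univ_product_univ,
      Finset.sum_product]
  have hcard := hT.card_edgeFinset
  -- A tree edge has distance 1 but truncated excess 0; adding 1 for it makes every edge of `G`
  -- contribute 2 plus its excess.
  have key : (∑ u, ∑ v, if G.Adj u v then T.dist u v else 0) +
      ∑ u, ∑ v, (if T.Adj u v then 1 else 0) =
      2 * (∑ u, ∑ v, if c u ≠ c v then 1 else 0) + excess T c Finset.univ := by
    simp only [excess, excessFrom, Finset.mul_sum, ← Finset.sum_add_distrib]
    refine Finset.sum_congr rfl fun u _ => Finset.sum_congr rfl fun v _ => ?_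
    by_cases hc : c u = c v
    · have h1 : ¬ G.Adj u v := fun h => (hG u v).1 h hc
      have h2 : ¬ T.Adj u v := fun h => h1 (hTG h)
      simp [hc, h1, h2]
    · have h1 := (hG u v).2 hc
      have h2 : 0 < T.dist u v := hT.connected.pos_dist_of_ne h1.ne
      by_cases h3 : T.Adj u v
      · simp [hc, h1, h3, dist_eq_one_iff_adj.2 h3]
      · have := hT.connected.one_lt_dist_of_ne_of_not_adj h1.ne h3
        simp only [h1, h3, hc, ne_eq, not_false_eq_true, if_true, if_false]
        omega
  rw [hedges] at key
  rw [two_mul_lpCongestion_one hT, ← hcard]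
  push_cast [← key]
  have := congrArg (Nat.cast : ℕ → ℝ) key
  push_cast at this
  linarith

end SimpleGraph

/-! ### The extremal tree -/

section TreeS

open SimpleGraph

variable {k : ℕ} {n : Fin k → ℕ} {i j : Fin k} {x : Fin (n i)} {y : Fin (n j)}

lemma treeS_adj_left {v : Σ l, Fin (n l)} (hv : v.1 ≠ i) : (treeS n i j x y).Adj ⟨i, x⟩ v := by
  rw [treeS, fromRel_adj]
  refine ⟨?_, .inl (.inl ⟨rfl, hv⟩)⟩
  rintro rfl
  exact hv rfl

lemma treeS_adj_right (hij : i ≠ j) {v : Σ l, Fin (n l)} (hv : v.1 = i) :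
    (treeS n i j x y).Adj ⟨j, y⟩ v := by
  rw [treeS, fromRel_adj]
  refine ⟨?_, .inl (.inr ⟨rfl, hv⟩)⟩
  rintro rfl
  exact hij hv.symm

lemma treeS_connected (hij : i ≠ j) : (treeS n i j x y).Connected := by
  have h (v) : (treeS n i j x y).Reachable ⟨i, x⟩ v := by
    by_cases hv : v.1 = i
    · exact (treeS_adj_left (v := ⟨j, y⟩) hij.symm).reachable.trans
        (treeS_adj_right hij hv).reachable
    · exact (treeS_adj_left hv).reachable
  exact { preconnected := fun u v => (h u).symm.trans (h v), nonempty := ⟨⟨i, x⟩⟩ }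

lemma treeS_le (hij : i ≠ j) : treeS n i j x y ≤ completeMultipartite n := by
  intro u v h
  rw [treeS, fromRel_adj] at h
  change u.1 ≠ v.1
  obtain ⟨-, (⟨rfl, h⟩ | ⟨rfl, h⟩) | (⟨rfl, h⟩ | ⟨rfl, h⟩)⟩ := h
  · exact h.symm
  · rw [h]; exact hij.symm
  · exact h
  · rw [h]; exact hij

open scoped Classical in
lemma treeS_isTree (hij : i ≠ j) : (treeS n i j x y).IsTree := by
  have hconn := treeS_connected (x := x) (y := y) hij
  refine isTree_iff_connected_and_card.2
    ⟨hconn, le_antisymm ?_ hconn.card_vert_le_card_edgeSet_add_one⟩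
  -- Each edge is charged to its endpoint farther from `x`, so there are at most as many edges as
  -- vertices other than `x`.
  have hsub : (treeS n i j x y).edgeFinset ⊆ (Finset.univ.erase ⟨i, x⟩).image
      fun v => if v.1 = i then s(⟨j, y⟩, v) else s(⟨i, x⟩, v) := by
    intro e
    induction e with
    | _ u v =>
    rw [mem_edgeFinset, mem_edgeSet, Finset.mem_image, treeS, fromRel_adj]
    rintro ⟨hne, (⟨rfl, h⟩ | ⟨rfl, h⟩) | (⟨rfl, h⟩ | ⟨rfl, h⟩)⟩
    · exact ⟨v, by simpa using hne.symm, by simp [h]⟩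
    · by_cases hv : v = ⟨i, x⟩
      · subst hv
        exact ⟨⟨j, y⟩, by simpa using hne, by simp [hij.symm, Sym2.eq_swap]⟩
      · exact ⟨v, by simpa using hv, by simp [h]⟩
    · exact ⟨u, by simpa using hne, by simp [h, Sym2.eq_swap]⟩
    · by_cases hu : u = ⟨i, x⟩
      · subst hu
        exact ⟨⟨j, y⟩, by simpa using hne.symm, by simp [hij.symm]⟩
      · exact ⟨u, by simpa using hu, by simp [h, Sym2.eq_swap]⟩
  have h := (Finset.card_le_card hsub).trans Finset.card_image_le
  rw [Finset.card_erase_of_mem (Finset.mem_univ _), Finset.card_univ] at h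
  rw [Nat.card_eq_fintype_card, Nat.card_eq_fintype_card, SimpleGraph.card_edgeSet]
  have : 0 < Fintype.card (Σ l, Fin (n l)) := Fintype.card_pos_iff.2 ⟨⟨i, x⟩⟩
  omega

lemma card_filter_fst_eq (i : Fin k) :
    (Finset.univ.filter fun v : Σ l, Fin (n l) => v.1 = i).card = n i := by
  rw [Finset.card_filter, Fintype.sum_sigma]
  simp [apply_ite]

/-- Only a point `u ≠ x` of part `i` and a point `v ≠ y` outside it can be more than 2 apart; the
walk `u, y, x, v` bounds their distance by 3. -/
lemma excess_treeS_le (hij : i ≠ j) :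
    excess (treeS n i j x y) Sigma.fst Finset.univ ≤
      2 * ((n i - 1) * (∑ l, n l - n i - 1)) := by
  let X : Σ l, Fin (n l) := ⟨i, x⟩
  let Y : Σ l, Fin (n l) := ⟨j, y⟩
  let A := (Finset.univ.filter fun v : Σ l, Fin (n l) => v.1 = i).erase X
  let B := (Finset.univ.filter fun v : Σ l, Fin (n l) => ¬ v.1 = i).erase Y
  have hcard := card_filter_fst_eq (n := n) i
  have hA : A.card = n i - 1 := by
    rw [Finset.card_erase_of_mem (by simp [X]), hcard]
  have hB : B.card = ∑ l, n l - n i - 1 := by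
    have h := Finset.card_filter_add_card_filter_not (s := Finset.univ)
      (fun v : Σ l, Fin (n l) => v.1 = i)
    rw [hcard, Finset.card_univ, Fintype.card_sigma] at h
    simp only [Fintype.card_fin] at h
    rw [Finset.card_erase_of_mem (by simp [Y, hij.symm])]
    omega
  have hle (C D : Finset (Σ l, Fin (n l))) :
      ∑ u, ∑ v, (if u ∈ C ∧ v ∈ D then 1 else 0) = C.card * D.card := by
    simp [ite_and, Finset.sum_ite_mem]
  have hX (v : Σ l, Fin (n l)) (hv : v.1 ≠ i) : (treeS n i j x y).Adj X v := treeS_adj_left hv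
  have hY (v : Σ l, Fin (n l)) (hv : v.1 = i) : (treeS n i j x y).Adj Y v :=
    treeS_adj_right hij hv
  have key (u v : Σ l, Fin (n l)) (hu : u.1 = i) (hv : v.1 ≠ i) :
      (treeS n i j x y).dist u v - 2 ≤ if u ∈ A ∧ v ∈ B then 1 else 0 := by
    by_cases huX : u = X
    · subst huX
      rw [dist_eq_one_iff_adj.2 (hX v hv)]
      simp
    by_cases hvY : v = Y
    · subst hvY
      rw [dist_eq_one_iff_adj.2 (hY u hu).symm]
      simp
    have := dist_le (Walk.cons (hY u hu).symm (.cons (hX Y hij.symm).symm (hX v hv).toWalk))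
    rw [if_pos ⟨by simp [A, huX, hu], by simp [B, hvY, hv]⟩]
    simp at this
    omega
  calc excess (treeS n i j x y) Sigma.fst Finset.univ
      ≤ ∑ u, ∑ v, ((if u ∈ A ∧ v ∈ B then 1 else 0) + if u ∈ B ∧ v ∈ A then 1 else 0) := by
        refine Finset.sum_le_sum fun u _ => Finset.sum_le_sum fun v _ => ?_
        rcases eq_or_ne u.1 v.1 with huv | huv
        · simp [huv]
        rw [if_pos huv]
        by_cases hu : u.1 = i
        · exact (key u v hu (fun h => huv (hu.trans h.symm))).trans (Nat.le_add_right _ _)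
        by_cases hv : v.1 = i
        · have := key v u hv hu
          simp only [dist_comm (u := v), and_comm (a := v ∈ A)] at this
          exact this.trans (Nat.le_add_left _ _)
        · have := dist_le (Walk.cons (hX u hu).symm (hX v hv).toWalk)
          simp at this
          omega
    _ = 2 * ((n i - 1) * (∑ l, n l - n i - 1)) := by
        simp only [Finset.sum_add_distrib, hle, hA, hB]
        ring

end TreeS

/-! ### Counting edges and the final formula -/

lemma sum_sum_ne_eq {k : ℕ} (m : Fin k → ℝ) (last : Fin k) (hlast : ∀ i, i ≤ last) :
    ∑ i, ∑ j, (if i ≠ j then m i * m j else 0) =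
      2 * (∑ i, ∑ j ∈ Finset.Ioo i last, m i * m j) + 2 * (m last * (∑ i, m i - m last)) := by
  have h1 : ∑ i, ∑ j, (if i ≠ j then m i * m j else 0) =
      2 * ∑ i, ∑ j, if i < j then m i * m j else 0 := by
    rw [two_mul]
    nth_rw 2 [Finset.sum_comm]
    rw [← Finset.sum_add_distrib]
    refine Finset.sum_congr rfl fun i _ => ?_
    rw [← Finset.sum_add_distrib]
    refine Finset.sum_congr rfl fun j _ => ?_
    rcases lt_trichotomy i j with h | rfl | h
    · simp [h, h.ne, h.not_gt]
    · simp
    · simp [h, h.ne', h.not_gt, mul_comm]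
  have h2 (i : Fin k) : (∑ j, if i < j then m i * m j else 0) =
      (∑ j ∈ Finset.Ioo i last, m i * m j) + (m i - if i = last then m i else 0) * m last := by
    rw [← Finset.sum_filter]
    rcases (hlast i).eq_or_lt with rfl | h
    · have h3 : Finset.univ.filter (i < ·) = ∅ := by
        ext j; simp [hlast j]
      simp [h3]
    · have h3 : Finset.univ.filter (i < ·) = insert last (Finset.Ioo i last) := by
        ext j
        simp only [Finset.mem_filter, Finset.mem_univ, true_and, Finset.mem_insert,
          Finset.mem_Ioo]
        refine ⟨fun hj => (hlast j).eq_or_lt.imp_right fun h' => ⟨hj, h'⟩, ?_⟩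
        rintro (rfl | hj)
        · exact h
        · exact hj.1
      rw [h3, Finset.sum_insert (by simp), if_neg h.ne]
      ring
  rw [h1]
  simp only [h2, Finset.sum_add_distrib, ← Finset.sum_mul, Finset.sum_sub_distrib]
  simp
  ring

lemma sum_sum_fst_ne {k : ℕ} (n : Fin k → ℕ) :
    ((∑ u : Σ l, Fin (n l), ∑ v : Σ l, Fin (n l), if u.1 ≠ v.1 then 1 else 0 : ℕ) : ℝ) =
      ∑ i, ∑ j, if i ≠ j then (n i : ℝ) * n j else 0 := by
  simp [Fintype.sum_sigma, Finset.mul_sum]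

theorem propositionp (k : ℕ) (hk : 3 ≤ k) (n : Fin k → ℕ) (hn : Antitone n)
    (first last : Fin k) (hfirst : (first : ℕ) = 0) (hlast : (last : ℕ) = k - 1)
    (hlast1 : 1 < n last) (x : Fin (n last)) (y : Fin (n first)) :
    IsSpanningTree (completeMultipartite n) (treeS n last first x y) ∧
    IsLeast (spanningTreeCongestions 1 (completeMultipartite n))
      (lpCongestion 1 (completeMultipartite n) (treeS n last first x y)) ∧
    lpCongestion 1 (completeMultipartite n) (treeS n last first x y) =
      2 * (∑ i : Fin k, ∑ j ∈ Finset.Ioo i last, (n i : ℝ) * (n j : ℝ)) +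
        3 * ((n last : ℝ) - 1) * ((∑ i : Fin k, (n i : ℝ)) - (n last : ℝ) - 1) +
        (∑ i : Fin k, (n i : ℝ)) - 1 := by
  have hne : last ≠ first := by
    rintro rfl
    omega
  have hmax (i : Fin k) : i ≤ last := by
    rw [Fin.le_def]
    have := i.2
    omega
  have hadj (u v : Σ l, Fin (n l)) : (completeMultipartite n).Adj u v ↔ u.1 ≠ v.1 := Iff.rfl
  have hspan : IsSpanningTree (completeMultipartite n) (treeS n last first x y) :=
    ⟨treeS_le hne, treeS_isTree hne⟩
  have hN : n last + 1 ≤ ∑ l, n l := by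
    have h1 : n first + n last ≤ ∑ l, n l := by
      rw [← Finset.sum_pair hne.symm]
      exact Finset.sum_le_sum_of_subset (Finset.subset_univ _)
    have h2 : n last ≤ n first := hn (hmax first)
    omega
  have hlower (T : SimpleGraph (Σ l, Fin (n l))) (hT : IsSpanningTree (completeMultipartite n) T) :
      2 * ((n last : ℝ) - 1) * ((∑ l, n l : ℝ) - n last - 1) ≤
        SimpleGraph.excess T Sigma.fst Finset.univ := by
    -- The choice of root is immaterial; `a` is the size of the smallest part.
    have h := hT.2.le_excess (c := Sigma.fst) (fun u v huv => hT.1 huv) ⟨last, x⟩ _ Finset.univ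
      (n last) rfl hlast1.le (by simp) (fun i => by
        rw [card_filter_fst_eq]
        exact hn (hmax i))
    rw [Finset.card_univ, Fintype.card_sigma] at h
    simp only [Fintype.card_fin] at h
    exact_mod_cast h
  have hvalue : (SimpleGraph.excess (treeS n last first x y) Sigma.fst Finset.univ : ℝ) =
      2 * ((n last : ℝ) - 1) * ((∑ l, n l : ℝ) - n last - 1) := by
    refine le_antisymm ?_ (hlower _ hspan)
    have h := excess_treeS_le (x := x) (y := y) hne
    rw [← Nat.cast_le (α := ℝ), Nat.sub_sub] at h
    push_cast [Nat.cast_sub hN, Nat.cast_sub hlast1.le] at h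
    linarith
  have hformula := SimpleGraph.two_mul_lpCongestion_one_add hadj hspan.1 hspan.2
  refine ⟨hspan, ⟨⟨_, hspan, rfl⟩, ?_⟩, ?_⟩
  · rintro _ ⟨T, hT, rfl⟩
    have h1 := SimpleGraph.two_mul_lpCongestion_one_add hadj hT.1 hT.2
    have h2 := hlower T hT
    rw [hvalue] at hformula
    linarith
  · rw [hvalue, sum_sum_fst_ne, sum_sum_ne_eq _ last hmax, Fintype.card_sigma] at hformula
    simp only [Fintype.card_fin, Nat.cast_sum] at hformula
    linarith
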